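/- Let $\Gamma$ be a hyperbolic group, i.e. a group acting by isometries, properly discontinuously and cocompactly on a nonempty proper geodesic metric space that is $\delta$-hyperbolic for some $\delta\ge 0$ (that is, $(x,y)_o\ge\min\{(x,z)_o,(z,y)_o\}-\delta$ for all points $x,y,z,o$, where $(x,y)_o=\frac12(d(x,o)+d(y,o)-d(x,y))$). For a length function $|\cdot|:\Gamma\to[0,\infty)$ (so $|e|=0$, $|\gamma^{-1}|=|\gamma|$, $|\gamma_1\gamma_2|\le|\gamma_1|+|\gamma_2|$), say that $(\Gamma,|\cdot|)$ has property RD if there exist $d>0$ and $C>0$ such that, for every $f:\Gamma\to\mathbb C$ with $$\|f\|_{H^d}^2:=\sum_{\gamma\in\Gamma}|f(\gamma)|^2(1+|\gamma|)^{2d}<\infty ,$$ left convolution by $f$, $(f*v)(x)=\sum_{\gamma\in\Gamma}f(\gamma)\,v(\gamma^{-1}x)$, is a well-defined bounded operator $\lambda_\Gamma(f)$ on $\ell^2(\Gamma)$ and $$\|\lambda_\Gamma(f)\|_{op}\le C\,\|f\|_{H^d}.$$ Then $\Gamma$ has property RD with respect to its natural length functions: 1. for every finite generating set $S$ of $\Gamma$,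 $\Gamma$ has property RD with respect to the word length of $S$, i.e. $|\gamma|$ is the least $n$ such that $\gamma$ is a product of $n$ elements of $S\cup S^{-1}$; 2. whenever $\Gamma$ acts by isometries, properly discontinuously and cocompactly on a proper, roughly geodesic, $\delta$-hyperbolic metric space $(X,d)$ (for some $\delta\ge0$) and $o\in X$, $\Gamma$ has property RD with respect to $|\gamma|=d(o,\gamma o)$. Here roughly geodesic means that there is $K>0$ such that any $x,y\in X$ can be written $x=r(a)$, $y=r(b)$ for some (not necessarily continuous) map $r:[a,b]\to X$ with $|t-s|-K\le d(r(t),r(s))\le|t-s|+K$ for all $s,t\in[a,b]$. In particular this holds for geodesic $X$. -/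

import Mathlib

universe u v w

/-! ### Hyperbolic metric spaces -/

/-- The Gromov product `(x, y)_o`. -/
noncomputable def gromovProduct {X : Type*} [MetricSpace X] (o x y : X) : ℝ :=
  (dist x o + dist y o - dist x y) / 2

/-- `X` is `δ`-hyperbolic for some `δ`. -/
def IsGromovHyperbolic (X : Type*) [MetricSpace X] : Prop :=
  ∃ δ : ℝ, ∀ o x y z : X,
    min (gromovProduct o x z) (gromovProduct o z y) - δ ≤ gromovProduct o x y

/-- Any two points are joined by an isometrically embedded compact interval. -/
def IsGeodesicSpace (X : Type*) [MetricSpace X] : Prop :=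
  ∀ x y : X, ∃ (a b : ℝ) (r : ℝ → X), a ≤ b ∧ r a = x ∧ r b = y ∧
    ∀ s ∈ Set.Icc a b, ∀ t ∈ Set.Icc a b, dist (r t) (r s) = |t - s|

/-- Any two points are joined by an interval that is embedded isometrically up to a
uniform additive constant. The map `r` need not be continuous. -/
def IsRoughlyGeodesicSpace (X : Type*) [MetricSpace X] : Prop :=
  ∃ C : ℝ, 0 < C ∧ ∀ x y : X, ∃ (a b : ℝ) (r : ℝ → X), a ≤ b ∧ r a = x ∧ r b = y ∧
    ∀ s ∈ Set.Icc a b, ∀ t ∈ Set.Icc a b,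
      |t - s| - C ≤ dist (r t) (r s) ∧ dist (r t) (r s) ≤ |t - s| + C

/-! ### Hyperbolic groups -/

/-- The action of `Γ` on the topological space `X` is cocompact: the quotient is compact. -/
def IsCocompactAction (Γ X : Type*) [Group Γ] [TopologicalSpace X] [MulAction Γ X] : Prop :=
  CompactSpace (Quotient (MulAction.orbitRel Γ X))

/-- `Γ` is hyperbolic: it acts by isometries, properly discontinuously and cocompactly on
a nonempty proper geodesic Gromov hyperbolic metric space. -/
def IsHyperbolicGroup (Γ : Type u) [Group Γ] : Prop :=
  ∃ (X : Type v) (_ : MetricSpace X) (_ : MulAction Γ X),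
    Nonempty X ∧ ProperSpace X ∧ IsGeodesicSpace X ∧ IsGromovHyperbolic X ∧
    IsIsometricSMul Γ X ∧ ProperlyDiscontinuousSMul Γ X ∧ IsCocompactAction Γ X

/-! ### Length functions -/

/-- A length function on a group. -/
structure LengthFunction (Γ : Type*) [Group Γ] where
  /-- The underlying function. -/
  toFun : Γ → ℝ
  nonneg : ∀ γ, 0 ≤ toFun γ
  map_one : toFun 1 = 0
  map_inv : ∀ γ, toFun γ⁻¹ = toFun γ
  map_mul_le : ∀ γ₁ γ₂, toFun (γ₁ * γ₂) ≤ toFun γ₁ + toFun γ₂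

/-- The length function `|γ| = d(o, γ o)` of an isometric action with base point `o`. -/
noncomputable def orbitLength (Γ : Type*) {X : Type*} [Group Γ] [MetricSpace X] [MulAction Γ X]
    [IsIsometricSMul Γ X] (o : X) : LengthFunction Γ where
  toFun γ := dist o (γ • o)
  nonneg _ := dist_nonneg
  map_one := by simp
  map_inv γ := by
    rw [← dist_smul γ o (γ⁻¹ • o), smul_inv_smul, dist_comm]
  map_mul_le γ₁ γ₂ := by
    calc dist o ((γ₁ * γ₂) • o) ≤ dist o (γ₁ • o) + dist (γ₁ • o) ((γ₁ * γ₂) • o) :=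
          dist_triangle _ _ _
      _ = dist o (γ₁ • o) + dist o (γ₂ • o) := by rw [mul_smul, dist_smul]

/-- `l` is a word in the letters `S ∪ S⁻¹` that spells `γ`. -/
def IsWordFor {Γ : Type*} [Group Γ] (S : Set Γ) (l : List Γ) (γ : Γ) : Prop :=
  (∀ s ∈ l, s ∈ S ∨ s⁻¹ ∈ S) ∧ l.prod = γ

/-- The least length of a word in `S ∪ S⁻¹` that spells `γ`. -/
noncomputable def minWordLength {Γ : Type*} [Group Γ] (S : Set Γ) (γ : Γ) : ℕ :=
  sInf {n : ℕ | ∃ l : List Γ, IsWordFor S l γ ∧ l.length = n}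

theorem minWordLength_le {Γ : Type*} [Group Γ] {S : Set Γ} {l : List Γ} {γ : Γ}
    (h : IsWordFor S l γ) : minWordLength S γ ≤ l.length :=
  Nat.sInf_le ⟨l, h, rfl⟩

theorem exists_minWord {Γ : Type*} [Group Γ] {S : Set Γ} (hS : Subgroup.closure S = ⊤) (γ : Γ) :
    ∃ l : List Γ, IsWordFor S l γ ∧ l.length = minWordLength S γ := by
  have hγ : γ ∈ Subgroup.closure S := hS ▸ Subgroup.mem_top γ
  rw [← Subgroup.mem_toSubmonoid, Subgroup.closure_toSubmonoid] at hγ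
  obtain ⟨l, hl, hp⟩ := Submonoid.exists_list_of_mem_closure hγ
  exact Nat.sInf_mem (s := {n : ℕ | ∃ l : List Γ, IsWordFor S l γ ∧ l.length = n})
    ⟨l.length, l, ⟨hl, hp⟩, rfl⟩

theorem minWordLength_inv_le {Γ : Type*} [Group Γ] {S : Set Γ} (hS : Subgroup.closure S = ⊤)
    (γ : Γ) : minWordLength S γ⁻¹ ≤ minWordLength S γ := by
  obtain ⟨l, ⟨hl, hp⟩, hn⟩ := exists_minWord hS γ
  have h : IsWordFor S (l.map (·⁻¹)).reverse γ⁻¹ := by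
    refine ⟨fun s hs => ?_, by rw [← List.prod_inv_reverse, hp]⟩
    simp only [List.mem_reverse, List.mem_map] at hs
    obtain ⟨t, ht, rfl⟩ := hs
    rw [inv_inv]
    exact (hl t ht).symm
  simpa [hn] using minWordLength_le h

theorem minWordLength_mul_le {Γ : Type*} [Group Γ] {S : Set Γ} (hS : Subgroup.closure S = ⊤)
    (γ₁ γ₂ : Γ) : minWordLength S (γ₁ * γ₂) ≤ minWordLength S γ₁ + minWordLength S γ₂ := by
  obtain ⟨l₁, ⟨h₁, p₁⟩, n₁⟩ := exists_minWord hS γ₁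
  obtain ⟨l₂, ⟨h₂, p₂⟩, n₂⟩ := exists_minWord hS γ₂
  have h : IsWordFor S (l₁ ++ l₂) (γ₁ * γ₂) := by
    refine ⟨fun s hs => ?_, by rw [List.prod_append, p₁, p₂]⟩
    rcases List.mem_append.1 hs with hs | hs
    exacts [h₁ s hs, h₂ s hs]
  simpa [n₁, n₂] using minWordLength_le h

/-- The word length of a group with respect to a generating set. -/
noncomputable def wordLength {Γ : Type*} [Group Γ] (S : Set Γ) (hS : Subgroup.closure S = ⊤) :
    LengthFunction Γ where
  toFun γ := (minWordLength S γ : ℝ)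
  nonneg _ := Nat.cast_nonneg _
  map_one := by
    have h : IsWordFor S [] (1 : Γ) := ⟨by simp, by simp⟩
    have := minWordLength_le h
    simpa using this
  map_inv γ := by
    have h₁ := minWordLength_inv_le hS γ
    have h₂ := minWordLength_inv_le hS γ⁻¹
    rw [inv_inv] at h₂
    rw [le_antisymm h₁ h₂]
  map_mul_le γ₁ γ₂ := by exact_mod_cast minWordLength_mul_le hS γ₁ γ₂

/-! ### Property RD -/

/-- `f` belongs to the Sobolev space `H^d(Γ)`. -/
def MemSobolev {Γ : Type*} [Group Γ] (L : LengthFunction Γ) (d : ℝ) (f : Γ → ℂ) : Prop :=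
  Summable fun γ => ‖f γ‖ ^ 2 * (1 + L.toFun γ) ^ (2 * d)

/-- The norm of `H^d(Γ)`. -/
noncomputable def sobolevNorm {Γ : Type*} [Group Γ] (L : LengthFunction Γ) (d : ℝ)
    (f : Γ → ℂ) : ℝ :=
  √(∑' γ, ‖f γ‖ ^ 2 * (1 + L.toFun γ) ^ (2 * d))

/-- `T` is the operator `λ_Γ(f) : v ↦ f ∗ v` on `ℓ²(Γ)`, where `λ_Γ` is the left regular
representation; the series `(f ∗ v)(x) = ∑_γ f(γ) v(γ⁻¹ x)` converges for all `v` and `x`. -/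
def IsLeftConvolution {Γ : Type*} [Group Γ] (f : Γ → ℂ)
    (T : lp (fun _ : Γ => ℂ) 2 →L[ℂ] lp (fun _ : Γ => ℂ) 2) : Prop :=
  ∀ (v : lp (fun _ : Γ => ℂ) 2) (x : Γ), HasSum (fun γ => f γ * v (γ⁻¹ * x)) (T v x)

/-- Property RD of `(Γ, L)`: for some `d, C > 0`, every `f ∈ H^d(Γ)` acts on `ℓ²(Γ)` by
left convolution as a bounded operator of norm at most `C ‖f‖_{H^d}`. -/
def HasPropertyRD {Γ : Type*} [Group Γ] (L : LengthFunction Γ) : Prop :=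
  ∃ d : ℝ, 0 < d ∧ ∃ C : ℝ, 0 < C ∧ ∀ f : Γ → ℂ, MemSobolev L d f →
    ∃ T : lp (fun _ : Γ => ℂ) 2 →L[ℂ] lp (fun _ : Γ => ℂ) 2,
      IsLeftConvolution f T ∧ ‖T‖ ≤ C * sobolevNorm L d f

/-! ### Counting orbit points near geodesics -/

section Geometry

variable {Γ : Type*} {X : Type*} [Group Γ] [MetricSpace X] [MulAction Γ X]

/-! Write `|g| = d(o, g o)`. Sort the pairs `(x, g)` in `∑_g F(g) V(g⁻¹ x)` by type `(m, j)`, the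
integer parts of `|g|` and of the Gromov product of `x o` and `g o`. For one type, Cauchy–Schwarz in
`g` and summation over `x` give `∑ F(g)² V(w)²`, weighted by the number of `x` for which `(x, g)`
and `(x, h)`, `h = x w⁻¹`, both have that type. Hyperbolicity bounds this number uniformly
(`encard_convolution_le`). An orbit point `a o` at distance about `j` from `o` towards `x o` lies
near geodesics from `o` to `g o` and to `h o`. So few `a` are possible given `g`; likewise `h⁻¹ a`
is near a geodesic from `o` to `w o`, at distance about `m - j`, and `x = a (h⁻¹ a)⁻¹ w`. As `j ≤
m`, summing over types costs only a power of `1 + |g|` (`tsum_sq_convolution_le`), which gives RD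
with `d = 3`. Word lengths follow because they dominate orbit lengths up to a factor. -/

theorem finite_setOf_dist_smul_le [ProperSpace X] [ProperlyDiscontinuousSMul Γ X] (o : X) (R : ℝ) :
    {γ : Γ | dist o (γ • o) ≤ R}.Finite := by
  refine (ProperlyDiscontinuousSMul.finite_disjoint_inter_image (Γ := Γ)
    (isCompact_singleton (x := o)) (isCompact_closedBall o R)).subset fun γ hγ => ?_
  have : γ • o ∈ (γ • ·) '' {o} ∩ Metric.closedBall o R :=
    ⟨⟨o, rfl, rfl⟩, by simpa [dist_comm] using hγ⟩
  exact ⟨_, this⟩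

theorem IsCocompactAction.exists_dist_smul_le [IsIsometricSMul Γ X]
    (h : IsCocompactAction Γ X) (o : X) : ∃ R : ℝ, ∀ y : X, ∃ a : Γ, dist (a • o) y ≤ R := by
  have : CompactSpace (Quotient (MulAction.orbitRel Γ X)) := h
  have hopen := isOpenMap_quotient_mk'_mul (Γ := Γ) (T := X)
  obtain ⟨n, hn⟩ := isCompact_univ.elim_directed_cover
    (fun n : ℕ => (Quotient.mk (MulAction.orbitRel Γ X)) '' Metric.ball o n)
    (fun n => hopen _ Metric.isOpen_ball)
    (fun q _ => by
      obtain ⟨y, rfl⟩ := Quotient.exists_rep q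
      obtain ⟨n, hn⟩ := exists_nat_gt (dist y o)
      exact Set.mem_iUnion.2 ⟨n, y, hn, rfl⟩)
    (Monotone.directed_le fun m n hmn =>
      Set.image_mono (Metric.ball_subset_ball (by exact_mod_cast hmn)))
  refine ⟨n, fun y => ?_⟩
  obtain ⟨z, hz, hzy⟩ := hn (Set.mem_univ (Quotient.mk (MulAction.orbitRel Γ X) y))
  obtain ⟨a, ha⟩ := MulAction.orbitRel_apply.1 (Quotient.exact hzy)
  refine ⟨a⁻¹, ?_⟩
  have ha : a • y = z := ha
  rw [← dist_smul a, smul_inv_smul, ha, dist_comm]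
  exact (Metric.mem_ball.1 hz).le

/-- Hyperbolicity puts two such orbit points within `3 * D + 2 * δ` of each other, and `D ≥ 0` once
the set is nonempty. Translating one of them to `o` leaves a finite set independent of `t` and `z`.
-/
theorem encard_near_geodesic_le [ProperSpace X] [IsIsometricSMul Γ X]
    [ProperlyDiscontinuousSMul Γ X] (hX : IsGromovHyperbolic X) (o : X) (D : ℝ) :
    ∃ N : ℕ, ∀ (t : ℝ) (z : X),
      {a : Γ | |dist o (a • o) - t| ≤ D ∧
        dist o (a • o) + dist (a • o) z ≤ dist o z + D}.encard ≤ N := by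
  obtain ⟨δ, hδ⟩ := hX
  have hfin := finite_setOf_dist_smul_le (Γ := Γ) o (5 * D + 2 * δ)
  refine ⟨{γ : Γ | dist o (γ • o) ≤ 5 * D + 2 * δ}.ncard, fun t z => ?_⟩
  rcases Set.eq_empty_or_nonempty {a : Γ | |dist o (a • o) - t| ≤ D ∧
        dist o (a • o) + dist (a • o) z ≤ dist o z + D} with h | ⟨a₀, ha₀, ha₀'⟩
  · simp [h]
  refine (Set.encard_le_encard (t := (a₀ * ·) '' {γ : Γ | dist o (γ • o) ≤ 5 * D + 2 * δ}) ?_).trans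
    ((Set.encard_image_le _ _).trans_eq hfin.cast_ncard_eq.symm)
  rintro a ⟨ha, ha'⟩
  refine ⟨a₀⁻¹ * a, ?_, by simp⟩
  have h := hδ o (a₀ • o) (a • o) z
  have e : dist o ((a₀⁻¹ * a) • o) = dist (a₀ • o) (a • o) := by
    rw [← dist_smul a₀, ← mul_smul, mul_inv_cancel_left]
  simp only [Set.mem_ofPred_eq, e]
  rw [abs_le] at ha ha₀
  simp only [gromovProduct, dist_comm _ o, dist_comm z] at h
  rcases min_choice ((dist o (a₀ • o) + dist o z - dist (a₀ • o) z) / 2)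
    ((dist o z + dist o (a • o) - dist (a • o) z) / 2) with h' | h' <;> rw [h'] at h <;>
    linarith

/-- A point of the orbit near the branch point of the triangle `o`, `x`, `z`, depending on `z` only
through the Gromov product `(x, z)_o`. -/
theorem exists_smul_near_branch [IsIsometricSMul Γ X] (hr : IsRoughlyGeodesicSpace X)
    (hX : IsGromovHyperbolic X) (hc : IsCocompactAction Γ X) (o : X) :
    ∃ D : ℝ, ∀ (t : ℝ) (x : X), 0 ≤ t → ∃ a : Γ, ∀ z : X, t ≤ gromovProduct o x z →
      gromovProduct o x z ≤ t + 1 →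
      |dist o (a • o) - t| ≤ D ∧ dist o (a • o) + dist (a • o) z ≤ dist o z + D ∧
      dist z (a • o) + dist (a • o) x ≤ dist z x + D := by
  obtain ⟨δ, hδ⟩ := hX
  obtain ⟨C, hC, hr⟩ := hr
  obtain ⟨R, hR⟩ := hc.exists_dist_smul_le o
  have hδ0 : 0 ≤ δ := by simpa using hδ o o o o
  have hR0 : 0 ≤ R := dist_nonneg.trans (hR o).choose_spec
  refine ⟨12 * C + 10 * R + 2 * δ + 2, fun t x ht => ?_⟩
  by_cases htx : t ≤ dist o x
  swap
  -- The Gromov product is at most `dist o x < t`, so no `z` qualifies and any `a` will do.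
  · refine ⟨1, fun z h₁ _ => absurd ?_ htx⟩
    have := dist_triangle o x z
    simp only [gromovProduct, dist_comm _ o] at h₁
    linarith
  obtain ⟨y, hy₁, hy₂, hy₃⟩ : ∃ y : X, t - 2 * C ≤ dist o y ∧ dist o y ≤ t + 2 * C ∧
      dist o y + dist y x ≤ dist o x + 4 * C := by
    obtain ⟨a, b, r, hab, rfl, rfl, h⟩ := hr o x
    have hba := h a ⟨le_rfl, hab⟩ b ⟨hab, le_rfl⟩
    rw [dist_comm, abs_of_nonneg (sub_nonneg.2 hab)] at hba
    by_cases htb : a + t ≤ b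
    · have h₁ := h a ⟨le_rfl, hab⟩ (a + t) ⟨by linarith, htb⟩
      have h₂ := h (a + t) ⟨by linarith, htb⟩ b ⟨hab, le_rfl⟩
      rw [dist_comm, abs_of_nonneg (by linarith)] at h₁ h₂
      exact ⟨r (a + t), by linarith, by linarith, by linarith⟩
    -- The interval is shorter than `t`, but by at most the rough constant since `t ≤ dist o x`; its
    -- endpoint `x` serves.
    · exact ⟨r b, by linarith, by linarith, by simp; linarith⟩
  obtain ⟨a, ha⟩ := hR y
  refine ⟨a, fun z h₁ h₂ => ?_⟩
  have t₁ := dist_triangle o (a • o) y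
  have t₂ := dist_triangle o y (a • o)
  have t₃ := dist_triangle (a • o) y x
  rw [dist_comm y] at t₂
  -- The products of `a • o` with `x` and of `x` with `z` are both about `t`, hence that of `a • o`
  -- with `z` is at least about `t`.
  have h := hδ o (a • o) z x
  simp only [gromovProduct, dist_comm _ o] at h h₁ h₂
  rw [dist_comm z x, dist_comm z (a • o)]
  rcases min_choice ((dist o (a • o) + dist o x - dist (a • o) x) / 2)
    ((dist o x + dist o z - dist x z) / 2) with h' | h' <;> rw [h'] at h <;>
  refine ⟨abs_le.2 ⟨by linarith, by linarith⟩, by linarith, by linarith⟩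

end Geometry

/-! ### Convolution estimates -/

section Convolution

open scoped ENNReal

theorem ENNReal.sq_tsum_mul_le {ι : Type*} (a b : ι → ℝ≥0∞) :
    (∑' i, a i * b i) ^ 2 ≤ (∑' i, a i ^ 2) * ∑' i, b i ^ 2 := by
  have h : ∑' i, a i * b i ≤ ((∑' i, a i ^ 2) * ∑' i, b i ^ 2) ^ (1 / 2 : ℝ) := by
    rw [ENNReal.tsum_eq_iSup_sum]
    refine iSup_le fun s => (ENNReal.inner_le_Lp_mul_Lq s a b Real.HolderConjugate.two_two).trans ?_
    rw [ENNReal.mul_rpow_of_nonneg _ _ (by norm_num)]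
    simp only [ENNReal.rpow_ofNat]
    gcongr <;> exact ENNReal.sum_le_tsum _
  calc (∑' i, a i * b i) ^ 2
      ≤ (((∑' i, a i ^ 2) * ∑' i, b i ^ 2) ^ (1 / 2 : ℝ)) ^ 2 := by gcongr
    _ = _ := by rw [← ENNReal.rpow_ofNat, ← ENNReal.rpow_mul]; norm_num

theorem ENNReal.tsum_ite_one_le {α : Type*} (p : α → Prop) [DecidablePred p] {N : ℕ}
    (h : {x | p x}.encard ≤ N) : ∑' x, (if p x then (1 : ℝ≥0∞) else 0) ≤ N := by
  have : ∑' x, (if p x then (1 : ℝ≥0∞) else 0) = {x | p x}.encard := by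
    rw [← ENNReal.tsum_set_one, tsum_subtype {x | p x} fun _ => (1 : ℝ≥0∞)]
    simp [Set.indicator_apply]
  rw [this]
  exact_mod_cast h

variable {G : Type*} [Group G] {κ : G → ℕ} {ι : G → G → ℕ}

/-- The part of a convolution coming from pairs of given type `(m, j)`. -/
theorem tsum_sq_restricted_convolution_le (hle : ∀ x g, ι x g ≤ κ g) {N : ℕ}
    (hN : ∀ g w j, {x | ι x g = j ∧ κ (x * w⁻¹) = κ g ∧ ι x (x * w⁻¹) = j}.encard ≤ N)
    (F V : G → ℝ≥0∞) (m j : ℕ) :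
    ∑' x, (∑' g, if κ g = m ∧ ι x g = j then F g * V (g⁻¹ * x) else 0) ^ 2 ≤
      ∑' g, (if κ g = m ∧ j ≤ κ g then F g ^ 2 else 0) * (N * ∑' w, V w ^ 2) := by
  -- An indicator equals its square, so each Cauchy–Schwarz factor keeps a copy.
  let e : G → G → ℝ≥0∞ := fun x g => if κ g = m ∧ ι x g = j then 1 else 0
  have he : ∀ x g, e x g ^ 2 = e x g := fun x g => by simp only [e]; split_ifs <;> simp
  have hcount : ∀ g w, ∑' x, e x g * e x (x * w⁻¹) ≤ if κ g = m ∧ j ≤ κ g then (N : ℝ≥0∞) else 0 := by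
    intro g w
    by_cases h : κ g = m ∧ j ≤ κ g
    · rw [if_pos h]
      refine le_trans (ENNReal.tsum_le_tsum fun x => ?_) (ENNReal.tsum_ite_one_le
        (fun x => ι x g = j ∧ κ (x * w⁻¹) = κ g ∧ ι x (x * w⁻¹) = j) (hN g w j))
      simp only [e, h.1, true_and]
      split_ifs <;> simp_all
    · rw [if_neg h]
      refine (ENNReal.tsum_eq_zero.2 fun x => ?_).le
      have : ¬ (κ g = m ∧ ι x g = j) := fun h' => h ⟨h'.1, h'.2 ▸ hle x g⟩
      simp [e, this]
  -- Substitution `g = x * w⁻¹`.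
  have hsubst : ∀ x, ∑' g, e x g * V (g⁻¹ * x) ^ 2 = ∑' w, e x (x * w⁻¹) * V w ^ 2 := fun x => by
    rw [← ((Equiv.inv G).trans (Equiv.mulLeft x)).tsum_eq]
    simp
  calc ∑' x, (∑' g, if κ g = m ∧ ι x g = j then F g * V (g⁻¹ * x) else 0) ^ 2
      = ∑' x, (∑' g, (e x g * F g) * (e x g * V (g⁻¹ * x))) ^ 2 := by
        congr! 5 with x g
        simp only [e]; split_ifs <;> simp
    _ ≤ ∑' x, (∑' g, e x g * F g ^ 2) * ∑' g, e x g * V (g⁻¹ * x) ^ 2 := by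
        refine ENNReal.tsum_le_tsum fun x => (ENNReal.sq_tsum_mul_le _ _).trans_eq ?_
        simp only [mul_pow, he]
    _ = ∑' x, ∑' g, ∑' w, F g ^ 2 * V w ^ 2 * (e x g * e x (x * w⁻¹)) := by
        congr! 2 with x
        rw [hsubst, ← ENNReal.tsum_mul_right]
        congr! 2 with g
        rw [← ENNReal.tsum_mul_left]
        congr! 2 with w
        ring
    _ = ∑' g, ∑' w, F g ^ 2 * V w ^ 2 * ∑' x, e x g * e x (x * w⁻¹) := by
        rw [ENNReal.tsum_comm]
        congr! 2 with g
        rw [ENNReal.tsum_comm]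
        simp only [ENNReal.tsum_mul_left]
    _ ≤ ∑' g, ∑' w, F g ^ 2 * V w ^ 2 * if κ g = m ∧ j ≤ κ g then (N : ℝ≥0∞) else 0 := by
        gcongr with g w
        exact hcount g w
    _ = ∑' g, (if κ g = m ∧ j ≤ κ g then F g ^ 2 else 0) * (N * ∑' w, V w ^ 2) := by
        congr! 2 with g
        simp only [mul_assoc, ENNReal.tsum_mul_left, ENNReal.tsum_mul_right]
        split_ifs <;> ring

/-- Only the `k + 1` types `(k, j)` with `j ≤ k` contribute, each at most `c * (k + 1) ^ 4`. The
exponent 5 is rounded up to 6, twice the Sobolev exponent 3. -/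
theorem tsum_sq_weight_le (k : ℕ) (c : ℝ≥0∞) :
    ∑' p : ℕ × ℕ, (((p.1 + 1 : ℝ≥0∞) * (p.2 + 1)) ^ 2 * if k = p.1 ∧ p.2 ≤ k then c else 0) ≤
      c * (k + 1) ^ 6 := by
  rw [ENNReal.tsum_prod', tsum_eq_single k, tsum_eq_sum (s := Finset.range (k + 1))]
  · calc _ ≤ ∑ j ∈ Finset.range (k + 1), (((k + 1 : ℝ≥0∞) * (k + 1)) ^ 2 * c) := by
          refine Finset.sum_le_sum fun j hj => ?_
          have hj : j ≤ k := Nat.lt_succ_iff.1 (Finset.mem_range.1 hj)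
          simp only [hj, true_and, if_true]
          gcongr
      _ = c * (k + 1) ^ 5 := by simp; ring
      _ ≤ c * (k + 1) ^ 6 := by gcongr <;> simp
  · intro j hj
    rw [if_neg, mul_zero]
    exact fun h => hj (Finset.mem_range.2 (Nat.lt_succ_of_le h.2))
  · intro m hm
    exact ENNReal.tsum_eq_zero.2 fun j => by rw [if_neg fun h => hm h.1.symm, mul_zero]

/-- Cauchy–Schwarz over the types with weights `(m + 1) * (j + 1)`, whose inverse squares are
summable; the weights themselves are absorbed by the power of `κ g + 1`. -/
theorem tsum_sq_convolution_le (hle : ∀ x g, ι x g ≤ κ g) {N : ℕ}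
    (hN : ∀ g w j, {x | ι x g = j ∧ κ (x * w⁻¹) = κ g ∧ ι x (x * w⁻¹) = j}.encard ≤ N)
    (F V : G → ℝ≥0∞) :
    ∑' x, (∑' g, F g * V (g⁻¹ * x)) ^ 2 ≤
      ((∑' n : ℕ, (n + 1 : ℝ≥0∞)⁻¹ ^ 2) ^ 2 * N) *
        ((∑' g, F g ^ 2 * (κ g + 1) ^ 6) * ∑' w, V w ^ 2) := by
  let c : ℕ × ℕ → ℝ≥0∞ := fun p => (p.1 + 1) * (p.2 + 1)
  have hc0 : ∀ p, c p ≠ 0 := fun p => by simp [c]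
  have hct : ∀ p, c p ≠ ∞ := fun p =>
    ENNReal.mul_ne_top (by finiteness) (by finiteness)
  have hsum : ∑' p, (c p)⁻¹ ^ 2 = (∑' n : ℕ, (n + 1 : ℝ≥0∞)⁻¹ ^ 2) ^ 2 := by
    rw [ENNReal.tsum_prod', sq (∑' n : ℕ, _), ← ENNReal.tsum_mul_right]
    congr! 2 with m
    rw [← ENNReal.tsum_mul_left]
    congr! 2 with n
    simp only [c]
    rw [ENNReal.mul_inv (by simp) (by simp), mul_pow]
  let S : ℕ × ℕ → G → ℝ≥0∞ := fun p x =>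
    ∑' g, if κ g = p.1 ∧ ι x g = p.2 then F g * V (g⁻¹ * x) else 0
  have hS : ∀ x, ∑' g, F g * V (g⁻¹ * x) = ∑' p, (c p)⁻¹ * (c p * S p x) := fun x => by
    simp only [← mul_assoc, ENNReal.inv_mul_cancel (hc0 _) (hct _), one_mul, S]
    rw [ENNReal.tsum_comm]
    congr! 2 with g
    rw [tsum_eq_single (κ g, ι x g)]
    · simp
    · exact fun p hp => if_neg fun h => hp (Prod.ext h.1.symm h.2.symm)
  calc ∑' x, (∑' g, F g * V (g⁻¹ * x)) ^ 2
      ≤ ∑' x, (∑' n : ℕ, (n + 1 : ℝ≥0∞)⁻¹ ^ 2) ^ 2 * ∑' p, c p ^ 2 * S p x ^ 2 := by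
        refine ENNReal.tsum_le_tsum fun x => ?_
        rw [hS x, ← hsum]
        exact (ENNReal.sq_tsum_mul_le _ _).trans_eq (by simp only [mul_pow])
    _ = (∑' n : ℕ, (n + 1 : ℝ≥0∞)⁻¹ ^ 2) ^ 2 * ∑' p, c p ^ 2 * ∑' x, S p x ^ 2 := by
        rw [ENNReal.tsum_mul_left, ENNReal.tsum_comm]
        simp only [ENNReal.tsum_mul_left]
    _ ≤ (∑' n : ℕ, (n + 1 : ℝ≥0∞)⁻¹ ^ 2) ^ 2 * ∑' p, c p ^ 2 *
          ∑' g, (if κ g = p.1 ∧ p.2 ≤ κ g then F g ^ 2 else 0) * (N * ∑' w, V w ^ 2) := by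
        refine mul_le_mul' le_rfl (ENNReal.tsum_le_tsum fun p => mul_le_mul' le_rfl ?_)
        exact tsum_sq_restricted_convolution_le hle hN F V p.1 p.2
    _ = (∑' n : ℕ, (n + 1 : ℝ≥0∞)⁻¹ ^ 2) ^ 2 *
          ((∑' g, ∑' p, c p ^ 2 * if κ g = p.1 ∧ p.2 ≤ κ g then F g ^ 2 else 0) *
            (N * ∑' w, V w ^ 2)) := by
        rw [ENNReal.tsum_comm, ← ENNReal.tsum_mul_right]
        congr! 3 with p
        rw [ENNReal.tsum_mul_right, ENNReal.tsum_mul_left, mul_assoc]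
    _ ≤ (∑' n : ℕ, (n + 1 : ℝ≥0∞)⁻¹ ^ 2) ^ 2 *
          ((∑' g, F g ^ 2 * (κ g + 1) ^ 6) * (N * ∑' w, V w ^ 2)) := by
        refine mul_le_mul' le_rfl (mul_le_mul' (ENNReal.tsum_le_tsum fun g => ?_) le_rfl)
        exact tsum_sq_weight_le _ _
    _ = _ := by rw [mul_left_comm _ (N : ℝ≥0∞), ← mul_assoc]

theorem tsum_inv_succ_sq_ne_top : ∑' n : ℕ, (n + 1 : ℝ≥0∞)⁻¹ ^ 2 ≠ ∞ := by
  have h := (summable_nat_add_iff 1).2 (Real.summable_nat_pow_inv.2 one_lt_two)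
  have e : ∀ n : ℕ, (n + 1 : ℝ≥0∞)⁻¹ ^ 2 = ENNReal.ofReal (((n + 1 : ℕ) : ℝ) ^ 2)⁻¹ := fun n => by
    rw [ENNReal.ofReal_inv_of_pos (by positivity), ENNReal.ofReal_pow (by positivity),
      ENNReal.ofReal_natCast, ENNReal.inv_pow, Nat.cast_add_one]
  simp only [e]
  rw [← ENNReal.ofReal_tsum_of_nonneg (fun _ => by positivity) h]
  exact ENNReal.ofReal_ne_top

end Convolution

/-! ### Property RD from estimates for nonnegative functions -/

section Operators

open scoped ENNReal

theorem tsum_enorm_sq_eq_ofReal {α : Type*} {g : α → ℂ} (hg : Summable fun x => ‖g x‖ ^ 2) :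
    ∑' x, ‖g x‖ₑ ^ 2 = ENNReal.ofReal (∑' x, ‖g x‖ ^ 2) := by
  rw [ENNReal.ofReal_tsum_of_nonneg (fun _ => by positivity) hg]
  congr! 2 with x
  rw [← ofReal_norm, ENNReal.ofReal_pow (norm_nonneg _)]

theorem lp.tsum_enorm_sq {α : Type*} (v : lp (fun _ : α => ℂ) 2) :
    ∑' x, ‖v x‖ₑ ^ 2 = ENNReal.ofReal (‖v‖ ^ 2) := by
  have h := lp.hasSum_norm (p := 2) (by norm_num) v
  simp only [ENNReal.toReal_ofNat, Real.rpow_ofNat] at h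
  rw [tsum_enorm_sq_eq_ofReal h.summable, h.tsum_eq]

theorem memℓp_two_of_tsum_enorm_sq_ne_top {α : Type*} {g : α → ℂ}
    (h : ∑' x, ‖g x‖ₑ ^ 2 ≠ ∞) : Memℓp g 2 := by
  refine memℓp_gen ?_
  have := ENNReal.summable_toReal h
  simpa using this

theorem lp.norm_le_of_tsum_enorm_sq_le {α : Type*} (v : lp (fun _ : α => ℂ) 2) {M : ℝ} (hM : 0 ≤ M)
    (h : ∑' x, ‖v x‖ₑ ^ 2 ≤ ENNReal.ofReal (M ^ 2)) : ‖v‖ ≤ M := by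
  rw [lp.tsum_enorm_sq, ENNReal.ofReal_le_ofReal_iff (by positivity)] at h
  exact (sq_le_sq₀ (norm_nonneg _) hM).1 h

variable {Γ : Type*} [Group Γ]

/-- Taking `V = ‖v‖ₑ` yields at once absolute convergence at every point, membership in `ℓ²` and the
norm bound. -/
theorem exists_isLeftConvolution_of_bound {f : Γ → ℂ} {M : ℝ} (hM : 0 ≤ M)
    (h : ∀ V : Γ → ℝ≥0∞, ∑' x, (∑' γ, ‖f γ‖ₑ * V (γ⁻¹ * x)) ^ 2 ≤
      ENNReal.ofReal (M ^ 2) * ∑' w, V w ^ 2) :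
    ∃ T : lp (fun _ : Γ => ℂ) 2 →L[ℂ] lp (fun _ : Γ => ℂ) 2,
      IsLeftConvolution f T ∧ ‖T‖ ≤ M := by
  have hb : ∀ v : lp (fun _ : Γ => ℂ) 2, ∑' x, (∑' γ, ‖f γ * v (γ⁻¹ * x)‖ₑ) ^ 2 ≤
      ENNReal.ofReal ((M * ‖v‖) ^ 2) := fun v => by
    simp only [enorm_mul]
    refine (h fun w => ‖v w‖ₑ).trans_eq ?_
    rw [lp.tsum_enorm_sq, mul_pow, ENNReal.ofReal_mul (by positivity)]
  have hs : ∀ (v : lp (fun _ : Γ => ℂ) 2) (x : Γ), Summable fun γ => f γ * v (γ⁻¹ * x) :=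
    fun v x => by
      have := ENNReal.ne_top_of_tsum_ne_top ((hb v).trans_lt ENNReal.ofReal_lt_top).ne x
      refine Summable.of_enorm fun h => this (by rw [h]; simp)
  have hle : ∀ v : lp (fun _ : Γ => ℂ) 2, ∑' x, ‖∑' γ, f γ * v (γ⁻¹ * x)‖ₑ ^ 2 ≤
      ENNReal.ofReal ((M * ‖v‖) ^ 2) := fun v =>
    (ENNReal.tsum_le_tsum fun x => pow_le_pow_left' (enorm_tsum_le_tsum_enorm) 2).trans (hb v)
  let T₀ : lp (fun _ : Γ => ℂ) 2 →ₗ[ℂ] lp (fun _ : Γ => ℂ) 2 :=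
    { toFun := fun v => ⟨fun x => ∑' γ, f γ * v (γ⁻¹ * x),
        memℓp_two_of_tsum_enorm_sq_ne_top ((hle v).trans_lt ENNReal.ofReal_lt_top).ne⟩
      map_add' := fun v w => by
        ext x
        simp only [lp.coeFn_add, Pi.add_apply, mul_add]
        exact (hs v x).tsum_add (hs w x)
      map_smul' := fun c v => by
        ext x
        simp only [lp.coeFn_smul, Pi.smul_apply, smul_eq_mul, RingHom.id_apply,
          mul_left_comm _ c, tsum_mul_left] }
  refine ⟨T₀.mkContinuous M fun v => ?_, fun v x => (hs v x).hasSum, T₀.mkContinuous_norm_le hM _⟩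
  exact lp.norm_le_of_tsum_enorm_sq_le _ (by positivity) (hle v)

theorem tsum_enorm_sq_mul_eq_sobolevNorm_sq {L : LengthFunction Γ} {d : ℝ} {f : Γ → ℂ}
    (hf : MemSobolev L d f) :
    ∑' γ, ‖f γ‖ₑ ^ 2 * ENNReal.ofReal ((1 + L.toFun γ) ^ (2 * d)) =
      ENNReal.ofReal (sobolevNorm L d f ^ 2) := by
  have h0 : ∀ γ, 0 ≤ (1 + L.toFun γ) ^ (2 * d) := fun γ =>
    Real.rpow_nonneg (add_nonneg zero_le_one (L.nonneg γ)) _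
  rw [sobolevNorm, Real.sq_sqrt (tsum_nonneg fun γ => mul_nonneg (by positivity) (h0 γ)),
    ENNReal.ofReal_tsum_of_nonneg (fun γ => mul_nonneg (by positivity) (h0 γ)) hf]
  congr! 2 with γ
  rw [ENNReal.ofReal_mul (by positivity), ← ofReal_norm, ENNReal.ofReal_pow (norm_nonneg _)]

theorem hasPropertyRD_of_bound {L : LengthFunction Γ} {d : ℝ} (hd : 0 < d) {K : ℝ≥0∞} (hK : K ≠ ∞)
    (h : ∀ F V : Γ → ℝ≥0∞, ∑' x, (∑' γ, F γ * V (γ⁻¹ * x)) ^ 2 ≤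
      K * ((∑' γ, F γ ^ 2 * ENNReal.ofReal ((1 + L.toFun γ) ^ (2 * d))) * ∑' w, V w ^ 2)) :
    HasPropertyRD L := by
  -- The summand 1 keeps the constant positive even if `K = 0`.
  refine ⟨d, hd, √K.toReal + 1, by positivity, fun f hf => ?_⟩
  have hS : 0 ≤ sobolevNorm L d f := Real.sqrt_nonneg _
  refine exists_isLeftConvolution_of_bound (by positivity) fun V => (h _ V).trans ?_
  rw [tsum_enorm_sq_mul_eq_sobolevNorm_sq hf, ← mul_assoc, mul_pow,
    ENNReal.ofReal_mul (by positivity)]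
  gcongr
  rw [ENNReal.le_ofReal_iff_toReal_le hK (by positivity)]
  nlinarith [Real.sq_sqrt (ENNReal.toReal_nonneg (a := K)), Real.sqrt_nonneg K.toReal]

/-- Since `M ≥ 1`, also `1 + L ≤ M * (1 + L')`, so the Sobolev norm grows by at most `M ^ d` in
passing from `L'` to `L`. -/
theorem HasPropertyRD.of_le {L L' : LengthFunction Γ} (hL : HasPropertyRD L) {M : ℝ} (hM : 1 ≤ M)
    (h : ∀ γ, L.toFun γ ≤ M * L'.toFun γ) : HasPropertyRD L' := by
  obtain ⟨d, hd, C, hC, H⟩ := hL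
  have hM0 : 0 < M := zero_lt_one.trans_le hM
  refine ⟨d, hd, C * M ^ d, by positivity, fun f hf => ?_⟩
  have hle : ∀ γ, ‖f γ‖ ^ 2 * (1 + L.toFun γ) ^ (2 * d) ≤
      M ^ (2 * d) * (‖f γ‖ ^ 2 * (1 + L'.toFun γ) ^ (2 * d)) := fun γ => by
    have h₁ := L.nonneg γ
    have h₂ := L'.nonneg γ
    rw [mul_left_comm, ← Real.mul_rpow hM0.le (by linarith)]
    gcongr
    linarith [h γ]
  have hf' : MemSobolev L d f := (hf.mul_left (M ^ (2 * d))).of_nonneg_of_le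
    (fun γ => mul_nonneg (by positivity)
      (Real.rpow_nonneg (add_nonneg zero_le_one (L.nonneg γ)) _)) hle
  obtain ⟨T, hT, hTn⟩ := H f hf'
  refine ⟨T, hT, hTn.trans ?_⟩
  rw [mul_assoc]
  gcongr
  refine Real.sqrt_le_iff.2 ⟨mul_nonneg (by positivity) (Real.sqrt_nonneg _), ?_⟩
  have h0 : 0 ≤ ∑' γ, ‖f γ‖ ^ 2 * (1 + L'.toFun γ) ^ (2 * d) := tsum_nonneg fun γ =>
    mul_nonneg (by positivity) (Real.rpow_nonneg (add_nonneg zero_le_one (L'.nonneg γ)) _)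
  rw [sobolevNorm, mul_pow, Real.sq_sqrt h0, ← Real.rpow_mul_natCast hM0.le, ← tsum_mul_left,
    Nat.cast_ofNat, mul_comm d]
  exact hf'.tsum_le_tsum hle (hf.mul_left _)

end Operators

/-! ### Hyperbolic groups -/

theorem LengthFunction.exists_le_mul_wordLength {Γ : Type*} [Group Γ] (L : LengthFunction Γ)
    {S : Set Γ} (hS : Subgroup.closure S = ⊤) (hfin : S.Finite) :
    ∃ M : ℝ, 1 ≤ M ∧ ∀ γ, L.toFun γ ≤ M * (wordLength S hS).toFun γ := by
  obtain ⟨M, hM⟩ := (hfin.image L.toFun).bddAbove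
  refine ⟨max M 1, le_max_right _ _, fun γ => ?_⟩
  obtain ⟨l, ⟨hl, rfl⟩, hn⟩ := exists_minWord hS γ
  have key : ∀ l : List Γ, (∀ s ∈ l, s ∈ S ∨ s⁻¹ ∈ S) → L.toFun l.prod ≤ max M 1 * l.length := by
    intro l
    induction l with
    | nil => simp [L.map_one]
    | cons s l ih =>
      intro h
      have hs : L.toFun s ≤ max M 1 := by
        refine le_trans ?_ (le_max_left _ _)
        rcases h s (by simp) with hs | hs
        · exact hM ⟨s, hs, rfl⟩
        · exact L.map_inv s ▸ hM ⟨_, hs, rfl⟩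
      have := ih fun t ht => h t (by simp [ht])
      have := L.map_mul_le s l.prod
      rw [List.prod_cons, List.length_cons]
      push_cast
      linarith
  refine (key l hl).trans_eq ?_
  rw [hn]
  rfl

theorem gromovProduct_nonneg {X : Type*} [MetricSpace X] (o x y : X) : 0 ≤ gromovProduct o x y := by
  have := dist_triangle x o y
  rw [dist_comm o] at this
  unfold gromovProduct
  linarith

theorem gromovProduct_le_dist {X : Type*} [MetricSpace X] (o x y : X) :
    gromovProduct o x y ≤ dist o y := by
  have := dist_triangle x y o
  rw [dist_comm o]
  unfold gromovProduct
  linarith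

theorem IsGeodesicSpace.isRoughlyGeodesicSpace {X : Type*} [MetricSpace X]
    (h : IsGeodesicSpace X) : IsRoughlyGeodesicSpace X := by
  refine ⟨1, one_pos, fun x y => ?_⟩
  obtain ⟨a, b, r, hab, ha, hb, hr⟩ := h x y
  exact ⟨a, b, r, hab, ha, hb, fun s hs t ht => by rw [hr s hs t ht]; constructor <;> linarith⟩

section RapidDecay

variable {Γ X : Type*} [Group Γ] [MetricSpace X] [ProperSpace X] [MulAction Γ X]
  [IsIsometricSMul Γ X] [ProperlyDiscontinuousSMul Γ X]

theorem encard_convolution_le (hr : IsRoughlyGeodesicSpace X) (hX : IsGromovHyperbolic X)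
    (hc : IsCocompactAction Γ X) (o : X) :
    ∃ N : ℕ, ∀ (g w : Γ) (j : ℕ),
      {x : Γ | ⌊gromovProduct o (x • o) (g • o)⌋₊ = j ∧
        ⌊dist o ((x * w⁻¹) • o)⌋₊ = ⌊dist o (g • o)⌋₊ ∧
        ⌊gromovProduct o (x • o) ((x * w⁻¹) • o)⌋₊ = j}.encard ≤ N := by
  obtain ⟨D, hD⟩ := exists_smul_near_branch hr hX hc o
  -- For `h = x * w⁻¹`, the distance from `h • o` to `a • o` is `|h| - |a|` up to `D`, `|a|` is `j`
  -- up to `D`, and the floor of `|h|` loses at most 1.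
  obtain ⟨N, hN⟩ := encard_near_geodesic_le (Γ := Γ) hX o (2 * D + 1)
  refine ⟨N * N, fun g w j => ?_⟩
  let A : ℝ → X → Set Γ := fun t z => {a : Γ | |dist o (a • o) - t| ≤ 2 * D + 1 ∧
        dist o (a • o) + dist (a • o) z ≤ dist o z + (2 * D + 1)}
  calc _ ≤ ((fun p : Γ × Γ => p.1 * p.2⁻¹ * w) '' (A j (g • o) ×ˢ
          A (⌊dist o (g • o)⌋₊ - j) (w • o))).encard := by
        refine Set.encard_le_encard ?_
        rintro x ⟨h₁, h₂, h₃⟩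
        have hfl : ∀ {r : ℝ} {n : ℕ}, 0 ≤ r → ⌊r⌋₊ = n → n ≤ r ∧ r ≤ n + 1 := fun h0 h =>
          ⟨((Nat.floor_eq_iff h0).1 h).1, ((Nat.floor_eq_iff h0).1 h).2.le⟩
        have k₁ := hfl (gromovProduct_nonneg _ _ _) h₁
        have k₂ := hfl dist_nonneg h₂
        have k₃ := hfl (gromovProduct_nonneg _ _ _) h₃
        -- The choice of `a` depends on `x` and `j` alone, so one `a` serves both `g` and `x * w⁻¹`.
        obtain ⟨a, ha⟩ := hD j (x • o) j.cast_nonneg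
        obtain ⟨a₁, a₂, -⟩ := ha _ k₁.1 k₁.2
        obtain ⟨b₁, b₂, b₃⟩ := ha _ k₃.1 k₃.2
        rw [abs_le] at a₁ b₁
        have hw : dist ((x * w⁻¹) • o) (x • o) = dist o (w • o) := by
          rw [← dist_smul (x * w⁻¹) o, ← mul_smul, inv_mul_cancel_right]
        have hb : dist o (((x * w⁻¹)⁻¹ * a) • o) = dist ((x * w⁻¹) • o) (a • o) := by
          rw [← dist_smul (x * w⁻¹) o, ← mul_smul, mul_inv_cancel_left]
        have hbw : dist (((x * w⁻¹)⁻¹ * a) • o) (w • o) = dist (a • o) (x • o) := by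
          rw [← dist_smul (x * w⁻¹), ← mul_smul, ← mul_smul, mul_inv_cancel_left,
            inv_mul_cancel_right]
        have t := dist_triangle o (a • o) ((x * w⁻¹) • o)
        rw [dist_comm (a • o) ((x * w⁻¹) • o)] at t b₂
        refine ⟨(a, (x * w⁻¹)⁻¹ * a), ⟨⟨abs_le.2 ⟨by linarith, by linarith⟩, by linarith⟩,
          abs_le.2 ⟨?_, ?_⟩, ?_⟩, by simp⟩
        all_goals
          simp only [hb, hbw]
          linarith
    _ ≤ (A j (g • o) ×ˢ A (⌊dist o (g • o)⌋₊ - j) (w • o)).encard := Set.encard_image_le _ _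
    _ ≤ N * N := by
        rw [Set.encard_prod]
        exact mul_le_mul' (hN _ _) (hN _ _)

theorem hasPropertyRD_orbitLength (hr : IsRoughlyGeodesicSpace X) (hX : IsGromovHyperbolic X)
    (hc : IsCocompactAction Γ X) (o : X) : HasPropertyRD (orbitLength Γ o) := by
  obtain ⟨N, hN⟩ := encard_convolution_le hr hX hc o
  refine hasPropertyRD_of_bound (d := 3) (by norm_num)
    (K := (∑' n : ℕ, (n + 1 : ENNReal)⁻¹ ^ 2) ^ 2 * N)
    (ENNReal.mul_ne_top (ENNReal.pow_ne_top tsum_inv_succ_sq_ne_top) (by simp)) fun F V => ?_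
  refine (tsum_sq_convolution_le (κ := fun g => ⌊dist o (g • o)⌋₊)
    (ι := fun x g => ⌊gromovProduct o (x • o) (g • o)⌋₊)
    (fun x g => Nat.floor_mono (gromovProduct_le_dist _ _ _)) hN F V).trans ?_
  refine mul_le_mul' le_rfl (mul_le_mul' (ENNReal.tsum_le_tsum fun g => mul_le_mul' le_rfl ?_)
    le_rfl)
  have h : (⌊dist o (g • o)⌋₊ + 1 : ENNReal) ≤ ENNReal.ofReal (1 + dist o (g • o)) := by
    rw [← Nat.cast_add_one, ← ENNReal.ofReal_natCast]
    refine ENNReal.ofReal_le_ofReal ?_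
    push_cast
    linarith [Nat.floor_le (dist_nonneg (x := o) (y := g • o))]
  calc _ ≤ ENNReal.ofReal (1 + dist o (g • o)) ^ 6 := pow_le_pow_left' h 6
    _ = ENNReal.ofReal ((1 + dist o (g • o)) ^ (2 * 3 : ℝ)) := by
        rw [← ENNReal.ofReal_pow (by positivity)]
        norm_num

end RapidDecay

theorem mainTheorem3 {Γ : Type u} [Group Γ] (hΓ : IsHyperbolicGroup.{u, v} Γ) :
    (∀ (S : Set Γ) (hS : Subgroup.closure S = ⊤), S.Finite → HasPropertyRD (wordLength S hS)) ∧
    (∀ (X : Type w) [MetricSpace X] [ProperSpace X] [MulAction Γ X] [IsIsometricSMul Γ X]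
      [ProperlyDiscontinuousSMul Γ X],
      IsRoughlyGeodesicSpace X → IsGromovHyperbolic X → IsCocompactAction Γ X →
      ∀ o : X, HasPropertyRD (orbitLength Γ o)) := by
  refine ⟨fun S hS hfin => ?_, fun X _ _ _ _ _ hr hX hc o => hasPropertyRD_orbitLength hr hX hc o⟩
  obtain ⟨X, _, _, ⟨o⟩, _, hgeo, hX, _, _, hc⟩ := hΓ
  obtain ⟨M, hM, hle⟩ := (orbitLength Γ o).exists_le_mul_wordLength hS hfin
  exact (hasPropertyRD_orbitLength hgeo.isRoughlyGeodesicSpace hX hc o).of_le hM hle
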